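/- Let $\mathbb{F}_q$ be a finite field with $q$ even, and let $n,k$ be integers with $3 \le k \le \frac q2 - 2$ and $$n > \begin{cases} \frac q2 + 1, & \text{if } k \in \{3, \frac q2 - 2\},\\ \frac q2, & \text{otherwise.}\end{cases}$$ Let $\alpha_1,\dots,\alpha_n \in \mathbb{F}_q$ be distinct and let $\eta \in \mathbb{F}_q$ with $\eta \neq 0$. Then the twisted Reed--Solomon code with one twist, twist $t=1$ and hook $h=k-1$, $$\mathcal{C} = \Big\{ \big(f(\alpha_1),\dots,f(\alpha_n)\big) : f = \sum_{i=0}^{k-1} f_i X^i + \eta f_{k-1} X^{k},\ f_0,\dots,f_{k-1} \in \mathbb{F}_q \Big\} \subseteq \mathbb{F}_q^n,$$ is not MDS, that is, its minimum Hamming distance $d$ does not satisfy $d = n - \dim_{\mathbb{F}_q} \mathcal{C} + 1$. -/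

import Mathlib

open Polynomial

noncomputable section

/-- The space of `[k, t, h, η]`-twisted polynomials with `ℓ` twists: all polynomials
`∑_{i < k} f_i X^i + ∑_{j} η_j f_{h_j} X^(k - 1 + t_j)` with coefficients `f_i` in `F`. -/
def twistedPolynomials {F : Type*} [Field F] (k : ℕ) {ℓ : ℕ}
    (t : Fin ℓ → ℕ) (h : Fin ℓ → Fin k) (η : Fin ℓ → F) : Submodule F F[X] where
  carrier := {p | ∃ f : Fin k → F,
    p = ∑ i : Fin k, C (f i) * X ^ (i : ℕ) + ∑ j : Fin ℓ, C (η j * f (h j)) * X ^ (k - 1 + t j)}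
  zero_mem' := ⟨0, by simp⟩
  add_mem' := by
    rintro _ _ ⟨f, rfl⟩ ⟨g, rfl⟩
    refine ⟨f + g, ?_⟩
    simp only [Pi.add_apply, mul_add, C_add, add_mul, Finset.sum_add_distrib]
    ring
  smul_mem' := by
    rintro c _ ⟨f, rfl⟩
    refine ⟨c • f, ?_⟩
    simp only [Pi.smul_apply, smul_eq_mul, smul_add, Finset.smul_sum, smul_eq_C_mul, C_mul]
    congr 1 <;> exact Finset.sum_congr rfl fun _ _ => by ring

/-- The evaluation map `f ↦ (f(α_1), …, f(α_n))`, as a linear map. -/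
def evaluationMap {F : Type*} [Field F] {n : ℕ} (α : Fin n → F) : F[X] →ₗ[F] (Fin n → F) :=
  LinearMap.pi fun i => Polynomial.leval (α i)

/-- The `[α, t, h, η]`-twisted Reed--Solomon code: the evaluation at `α_1, …, α_n` of the
`[k, t, h, η]`-twisted polynomials. It is used for distinct `α_i`, `k < n`, `1 ≤ t_j ≤ n - k`
and distinct pairs `(h_j, t_j)`. -/
def twistedRSCode {F : Type*} [Field F] {n : ℕ} (k : ℕ) {ℓ : ℕ} (α : Fin n → F)
    (t : Fin ℓ → ℕ) (h : Fin ℓ → Fin k) (η : Fin ℓ → F) : Submodule F (Fin n → F) :=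
  (twistedPolynomials k t h η).map (evaluationMap α)

/-- The minimum Hamming distance between distinct codewords of a linear code
(with value `0` for the zero code). -/
def minimumDistance {F : Type*} [Field F] [DecidableEq F] {n : ℕ}
    (C : Submodule F (Fin n → F)) : ℕ :=
  sInf {d | ∃ x ∈ C, ∃ y ∈ C, x ≠ y ∧ hammingDist x y = d}

/-- A linear code of length `n` is MDS (maximum distance separable) if it attains the Singleton
bound: its minimum distance `d` and dimension satisfy `d + dim = n + 1`. -/
def IsMDS {F : Type*} [Field F] [DecidableEq F] {n : ℕ} (C : Submodule F (Fin n → F)) : Prop :=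
  minimumDistance C + Module.finrank F C = n + 1

end

/-! If `k` evaluation points sum to `-η⁻¹`, the monic polynomial with these roots is twisted, so
some codeword has weight `n - k`; as the dimension is at most `k`, the code is not MDS. It remains
to find such points in a set `A` of more than half of an elementary abelian 2-group.

Disjoint pairs `{x, x + c}` in `A` each add `c`, so a sum of 2 or 3 elements grows to `k` elements,
changing only by `0` or `c` (`IsSubsetSum.add_pairs`). Double counting gives a `c` with many pairs
(`exists_le_card_pairedElements`). Two-sums miss at most `0`, three-sums at most one element
(`eq_of_not_isSubsetSum_three`); choosing `c` or a longer start avoids these. Complements handle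
large `k`. -/

/-! ### Subset sums and pairs in elementary abelian 2-groups -/

section SubsetSums

variable {G : Type*} [AddCommGroup G]

/-- `b` is a sum of `k` distinct elements of `A`. -/
def IsSubsetSum (A : Finset G) (k : ℕ) (b : G) : Prop :=
  ∃ S ⊆ A, S.card = k ∧ ∑ x ∈ S, x = b

theorem IsSubsetSum.mono {A B : Finset G} {k : ℕ} {b : G} (h : IsSubsetSum A k b) (hAB : A ⊆ B) :
    IsSubsetSum B k b := by
  obtain ⟨S, hS, h⟩ := h
  exact ⟨S, hS.trans hAB, h⟩

theorem add_add_self_cancel (h2 : ∀ x : G, x + x = 0) (x c : G) : x + c + c = x := by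
  rw [add_assoc, h2, add_zero]

theorem eq_of_add_eq_zero_of_two (h2 : ∀ x : G, x + x = 0) {x y : G} (h : x + y = 0) : x = y := by
  rw [← add_add_self_cancel h2 x y, h, zero_add]

theorem even_nsmul_of_two (h2 : ∀ x : G, x + x = 0) {j : ℕ} (hj : Even j) (c : G) :
    j • c = 0 := by
  obtain ⟨i, rfl⟩ := hj
  rw [add_nsmul, h2]

theorem odd_nsmul_of_two (h2 : ∀ x : G, x + x = 0) {j : ℕ} (hj : Odd j) (c : G) :
    j • c = c := by
  obtain ⟨i, rfl⟩ := hj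
  rw [add_nsmul, one_nsmul, even_nsmul_of_two h2 (even_two_mul i), zero_add]

/-- Translation by `c` is an involution of `P` without fixed points. -/
theorem even_card_of_forall_add_mem (h2 : ∀ x : G, x + x = 0) {P : Finset G} {c : G} (hc : c ≠ 0)
    (hP : ∀ x ∈ P, x + c ∈ P) : Even P.card := by
  have : ∑ _x ∈ P, (1 : ZMod 2) = 0 :=
    Finset.sum_involution (fun x _ => x + c) (fun _ _ => by decide)
      (fun x _ _ h => hc (by simpa using h)) (fun x hx => hP x hx)
      (fun x _ => add_add_self_cancel h2 x c)
  rw [Finset.sum_const, nsmul_eq_mul, mul_one] at this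
  exact (ZMod.natCast_eq_zero_iff_even).1 this

variable [DecidableEq G]

/-- Those elements of `A` whose translate by `c` lies in `A` as well. -/
def pairedElements (A : Finset G) (c : G) : Finset G := A.filter fun x => x + c ∈ A

theorem mem_pairedElements {A : Finset G} {c x : G} :
    x ∈ pairedElements A c ↔ x ∈ A ∧ x + c ∈ A := by
  simp [pairedElements]

theorem pairedElements_subset (A : Finset G) (c : G) : pairedElements A c ⊆ A :=
  Finset.filter_subset _ _

theorem IsSubsetSum.compl {A : Finset G} {k l : ℕ} {b : G} (hkl : k + l = A.card)
    (h : IsSubsetSum A k (∑ x ∈ A, x - b)) : IsSubsetSum A l b := by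
  obtain ⟨S, hS, hc, hs⟩ := h
  refine ⟨A \ S, Finset.sdiff_subset, ?_, ?_⟩
  · rw [Finset.card_sdiff_of_subset hS]; omega
  · have := Finset.sum_sdiff (f := fun x => x) hS
    rw [hs] at this
    rw [← sub_eq_zero] at this ⊢
    rw [← this]; abel

theorem add_mem_pairedElements (h2 : ∀ x : G, x + x = 0) {A : Finset G} {c x : G}
    (hx : x ∈ pairedElements A c) : x + c ∈ pairedElements A c := by
  rw [mem_pairedElements] at hx ⊢
  exact ⟨hx.2, by rw [add_add_self_cancel h2]; exact hx.1⟩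

/-- A set stable under translation by `c` contains `j` disjoint pairs `{x, x + c}`. -/
theorem exists_pairs_of_forall_add_mem (h2 : ∀ x : G, x + x = 0) {c : G} (hc : c ≠ 0) (j : ℕ) :
    ∀ P : Finset G, (∀ x ∈ P, x + c ∈ P) → 2 * j ≤ P.card + 1 → IsSubsetSum P (2 * j) (j • c) := by
  induction j with
  | zero => exact fun P _ _ => ⟨∅, by simp⟩
  | succ j ih =>
    intro P hP hj
    -- One element brings its partner along, so the bound can afford the `+ 1`.
    obtain ⟨x, hx⟩ : P.Nonempty := by
      rw [← Finset.card_pos]; omega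
    have hne : x ≠ x + c := fun h => hc (by simpa using h.symm)
    have hsub : ({x, x + c} : Finset G) ⊆ P := by
      intro y hy
      rw [Finset.mem_insert, Finset.mem_singleton] at hy
      rcases hy with rfl | rfl
      · exact hx
      · exact hP _ hx
    have hcard : ({x, x + c} : Finset G).card = 2 := Finset.card_pair hne
    obtain ⟨S, hS, hSc, hSs⟩ := ih (P \ {x, x + c}) (by
      intro y hy
      simp only [Finset.mem_sdiff, Finset.mem_insert, Finset.mem_singleton, not_or] at hy ⊢
      refine ⟨hP y hy.1, fun h => hy.2.2 ?_, fun h => hy.2.1 (add_right_cancel h)⟩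
      rw [← h, add_add_self_cancel h2]) (by
      rw [Finset.card_sdiff_of_subset hsub, hcard]; omega)
    have hdisj : Disjoint S {x, x + c} :=
      Finset.disjoint_of_subset_left hS Finset.sdiff_disjoint
    refine ⟨S ∪ {x, x + c}, Finset.union_subset (hS.trans Finset.sdiff_subset) hsub, ?_, ?_⟩
    · rw [Finset.card_union_of_disjoint hdisj, hSc, hcard]; ring
    · rw [Finset.sum_union hdisj, hSs, Finset.sum_pair hne, ← add_assoc x, h2, zero_add, succ_nsmul]

/-- Removing `T` and `T + c` costs at most `2 * t` paired elements and leaves a set stable under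
`c`; `j` pairs from it cancel `j • c`. -/
theorem IsSubsetSum.add_pairs (h2 : ∀ x : G, x + x = 0) {A : Finset G} {c : G} (hc : c ≠ 0)
    {t j : ℕ} {b : G} (h : IsSubsetSum A t (b + j • c))
    (hj : 2 * (t + j) ≤ (pairedElements A c).card + 1) : IsSubsetSum A (t + 2 * j) b := by
  obtain ⟨T, hT, hTc, hTs⟩ := h
  have hcard : (T ∪ T.image (· + c)).card ≤ 2 * t := by
    have h1 := Finset.card_union_le T (T.image (· + c))
    have h3 : (T.image (· + c)).card ≤ T.card := Finset.card_image_le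
    omega
  obtain ⟨S, hS, hSc, hSs⟩ := exists_pairs_of_forall_add_mem h2 hc j
    (pairedElements A c \ (T ∪ T.image (· + c))) (by
      intro y hy
      simp only [Finset.mem_sdiff, Finset.mem_union, Finset.mem_image, not_or, not_exists,
        not_and] at hy ⊢
      refine ⟨add_mem_pairedElements h2 hy.1, fun h => hy.2.2 _ h (add_add_self_cancel h2 y c),
        fun x hx h => hy.2.1 ?_⟩
      rwa [← add_right_cancel h]) (by
      have := Finset.le_card_sdiff (T ∪ T.image (· + c)) (pairedElements A c)
      omega)
  have hdisj : Disjoint T S := by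
    refine Finset.disjoint_of_subset_right hS ?_
    exact Finset.disjoint_of_subset_left Finset.subset_union_left Finset.disjoint_sdiff
  refine ⟨T ∪ S, Finset.union_subset hT
    ((hS.trans Finset.sdiff_subset).trans (pairedElements_subset A c)), ?_, ?_⟩
  · rw [Finset.card_union_of_disjoint hdisj, hTc, hSc]
  · rw [Finset.sum_union hdisj, hTs, hSs, add_assoc, h2, add_zero]

/-- Write `b = z + u + (u + (b + z))`; the summands are distinct once `u` avoids `z` and `b`, hence
the bound 2. -/
theorem isSubsetSum_three_of_card_pairedElements (h2 : ∀ x : G, x + x = 0) {A : Finset G}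
    {b z : G} (hz : z ∈ A) (hbz : b ≠ z) (h : 2 < (pairedElements A (b + z)).card) :
    IsSubsetSum A 3 b := by
  have hd : b + z ≠ 0 := fun h => hbz (eq_of_add_eq_zero_of_two h2 h)
  obtain ⟨u, hu, hu'⟩ : ∃ u ∈ pairedElements A (b + z), u ∉ ({z, b} : Finset G) := by
    apply Finset.exists_mem_notMem_of_card_lt_card
    have := Finset.card_le_two (a := z) (b := b)
    omega
  simp only [Finset.mem_insert, Finset.mem_singleton, not_or] at hu'
  rw [mem_pairedElements] at hu
  have h1 : u ≠ u + (b + z) := fun h => hd (by simpa using h.symm)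
  have h3 : z ≠ u + (b + z) := by
    intro h
    apply hu'.2
    apply eq_of_add_eq_zero_of_two h2
    rw [← add_assoc] at h
    simpa using h.symm
  have h4 : z ∉ ({u, u + (b + z)} : Finset G) := by
    simp only [Finset.mem_insert, Finset.mem_singleton, not_or]
    exact ⟨fun h => hu'.1 h.symm, h3⟩
  refine ⟨insert z {u, u + (b + z)}, ?_, ?_, ?_⟩
  · intro y hy
    simp only [Finset.mem_insert, Finset.mem_singleton] at hy
    rcases hy with rfl | rfl | rfl
    exacts [hz, hu.1, hu.2]
  · rw [Finset.card_insert_of_notMem h4, Finset.card_pair h1]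
  · rw [Finset.sum_insert h4, Finset.sum_pair h1, ← add_assoc u u, h2, zero_add, add_comm b z,
      ← add_assoc, h2, zero_add]

/-- The paired elements are even in number, while `A` has odd size. -/
theorem card_pairedElements_le (h2 : ∀ x : G, x + x = 0) {M : ℕ} {A : Finset G}
    (hA : A.card = 8 * M + 1) {c : G}
    (hc : c ≠ 0) : (pairedElements A c).card ≤ 8 * M := by
  have h1 := Finset.card_le_card (pairedElements_subset A c)
  obtain ⟨r, hr⟩ := even_card_of_forall_add_mem h2 hc
    (fun x hx => add_mem_pairedElements (A := A) h2 hx)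
  omega

theorem card_pairedElements_le_two_of_not_isSubsetSum_three (h2 : ∀ x : G, x + x = 0) {A : Finset G} {b : G}
    (hb : ¬ IsSubsetSum A 3 b) {d : G} (hd : d ∈ (A.image (b + ·)).erase 0) :
    (pairedElements A d).card ≤ 2 := by
  rw [Finset.mem_erase, Finset.mem_image] at hd
  obtain ⟨hd0, z, hz, rfl⟩ := hd
  by_contra! h
  exact hb (isSubsetSum_three_of_card_pairedElements h2 hz (fun h => hd0 (by rw [h, h2])) h)

/-! ### Counting pairs by their difference -/

variable [Fintype G]

theorem le_card_pairedElements (A : Finset G) (c : G) :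
    2 * A.card ≤ (pairedElements A c).card + Fintype.card G := by
  have h1 : pairedElements A c = A ∩ A.image (· - c) := by
    ext x
    simp only [mem_pairedElements, Finset.mem_inter, Finset.mem_image]
    refine and_congr_right fun _ => ⟨fun h => ⟨_, h, by abel⟩, ?_⟩
    rintro ⟨y, hy, rfl⟩
    simpa using hy
  have h3 : (A.image (· - c)).card = A.card :=
    Finset.card_image_of_injective _ (sub_left_injective)
  have h4 := Finset.card_union_add_card_inter A (A.image (· - c))
  have h5 := Finset.card_le_univ (A ∪ A.image (· - c))
  rw [h1]; omega

/-- Each `(x, y)` in `A × A` is counted once, at `c = y - x`. -/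
theorem sum_card_pairedElements (A : Finset G) :
    ∑ c, (pairedElements A c).card = A.card * A.card := by
  simp only [pairedElements, Finset.card_filter]
  rw [Finset.sum_comm]
  rw [Finset.sum_const_nat (m := A.card)]
  intro x _
  rw [← Finset.card_filter]
  refine Finset.card_bij (fun c _ => x + c) (by simp) (fun _ _ _ _ h => add_left_cancel h) ?_
  exact fun y hy => ⟨y - x, by simpa using hy, by abel⟩

theorem isSubsetSum_two (h2 : ∀ x : G, x + x = 0) {A : Finset G}
    (hA : Fintype.card G < 2 * A.card) {b : G} (hb : b ≠ 0) : IsSubsetSum A 2 b := by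
  obtain ⟨x, hx⟩ : (pairedElements A b).Nonempty := by
    rw [← Finset.card_pos]
    have := le_card_pairedElements A b
    omega
  rw [mem_pairedElements] at hx
  have hne : x ≠ x + b := fun h => hb (by simpa using h.symm)
  refine ⟨{x, x + b}, ?_, Finset.card_pair hne, ?_⟩
  · intro y hy
    rw [Finset.mem_insert, Finset.mem_singleton] at hy
    rcases hy with rfl | rfl
    exacts [hx.1, hx.2]
  · rw [Finset.sum_pair hne, ← add_assoc, h2, zero_add]

theorem isSubsetSum_three (h2 : ∀ x : G, x + x = 0) {A : Finset G}
    (hA : Fintype.card G + 4 ≤ 2 * A.card) (b : G) : IsSubsetSum A 3 b := by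
  have hG : 0 < Fintype.card G := Fintype.card_pos_iff.2 ⟨0⟩
  obtain ⟨z, hz, hzb⟩ := Finset.exists_mem_ne (show 1 < A.card by omega) b
  refine isSubsetSum_three_of_card_pairedElements h2 hz hzb.symm ?_
  have := le_card_pairedElements A (b + z)
  omega

/-- If few elements of `A` are paired by the elements of `D`, many are paired by some other `c`. -/
theorem exists_le_card_pairedElements {A D : Finset G} (hD : (0 : G) ∉ D) {u v : ℕ}
    (hu : ∀ d ∈ D, (pairedElements A d).card ≤ u)
    (hv : A.card + u * D.card + v * (Fintype.card G - 1 - D.card) < A.card * A.card) :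
    ∃ c ∉ D, c ≠ 0 ∧ v < (pairedElements A c).card := by
  by_contra! hcon
  have h0 : (pairedElements A 0).card = A.card := by simp [pairedElements]
  have h1 := sum_card_pairedElements A
  have hD' : D ⊆ Finset.univ.erase 0 := fun x hx =>
    Finset.mem_erase.2 ⟨fun h => hD (h ▸ hx), Finset.mem_univ _⟩
  rw [← Finset.add_sum_erase _ _ (Finset.mem_univ (0 : G)), h0, ← Finset.sum_sdiff hD'] at h1
  have h3 : ∑ d ∈ D, (pairedElements A d).card ≤ D.card * u := by
    simpa using Finset.sum_le_card_nsmul D _ u hu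
  have h4 : ∑ d ∈ Finset.univ.erase 0 \ D, (pairedElements A d).card ≤
      (Finset.univ.erase 0 \ D).card * v := by
    refine (Finset.sum_le_card_nsmul _ _ v fun d hd => ?_).trans_eq (by simp)
    rw [Finset.mem_sdiff, Finset.mem_erase] at hd
    exact hcon d hd.2 hd.1.1
  rw [Finset.card_sdiff_of_subset hD', Finset.card_erase_of_mem (Finset.mem_univ _),
    Finset.card_univ] at h4
  rw [mul_comm u, mul_comm v] at hv
  omega

/-! ### Sets with one element more than half the group -/

section HalfPlusOne

variable {M : ℕ} {A : Finset G}

theorem exists_ne_lt_card_pairedElements (h2 : ∀ x : G, x + x = 0)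
    (hG : Fintype.card G = 16 * M) (hM : 0 < M) (hA : A.card = 8 * M + 1) (e : G) :
    ∃ c ≠ e, c ≠ 0 ∧ 4 * M < (pairedElements A c).card := by
  -- For `e = 0` any nonzero element serves as a dummy exclusion.
  obtain ⟨e', he', hee'⟩ : ∃ e' : G, e' ≠ 0 ∧ (e ≠ 0 → e' = e) := by
    by_cases he : e = 0
    · have : Nontrivial G := Fintype.one_lt_card_iff_nontrivial.1 (by omega)
      obtain ⟨x, hx⟩ := exists_ne (0 : G)
      exact ⟨x, hx, fun h => absurd he h⟩
    · exact ⟨e, he, fun _ => rfl⟩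
  obtain ⟨c, hcD, hc0, hc⟩ := exists_le_card_pairedElements (A := A) (D := {e'}) (u := 8 * M)
    (v := 4 * M) (by simpa using he'.symm)
    (by intro d hd; rw [Finset.mem_singleton] at hd; subst hd
        exact card_pairedElements_le h2 hA he')
    (by
      rw [hA, hG, Finset.card_singleton]
      obtain ⟨m, rfl⟩ : ∃ m, M = m + 1 := ⟨M - 1, by omega⟩
      have : 16 * (m + 1) - 1 - 1 = 16 * m + 14 := by omega
      rw [this]; nlinarith)
  refine ⟨c, fun h => ?_, hc0, hc⟩
  subst h
  exact hcD (by simp [hee' hc0])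

/-- Start from two elements. If `4 ∣ k`, the number of pairs is odd and `c ≠ b` keeps the target `b
+ c` nonzero. Otherwise the target is `b` itself, and `b = 0` needs a start of four. -/
theorem isSubsetSum_of_even (h2 : ∀ x : G, x + x = 0)
    (hG : Fintype.card G = 16 * M) (hA : A.card = 8 * M + 1) {k : ℕ}
    (hk : 4 ≤ k) (hkM : k ≤ 4 * M) (hke : Even k) (b : G) : IsSubsetSum A k b := by
  have key : ∀ {k : ℕ} (b : G), 4 ≤ k → k ≤ 4 * M → k % 4 = 0 → IsSubsetSum A k b := by
    intro k b hk hkM hk4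
    obtain ⟨c, hcb, hc0, hc⟩ := exists_ne_lt_card_pairedElements h2 hG (by omega) hA b
    obtain ⟨j, rfl⟩ : ∃ j, k = 2 + 2 * j := ⟨(k - 2) / 2, by omega⟩
    refine IsSubsetSum.add_pairs h2 hc0 (isSubsetSum_two h2 (by omega) ?_) (by omega)
    rw [odd_nsmul_of_two h2 (Nat.odd_iff.2 (by omega))]
    exact fun h => hcb (eq_of_add_eq_zero_of_two h2 h).symm
  rw [Nat.even_iff] at hke
  by_cases hk4 : k % 4 = 0
  · exact key b hk hkM hk4
  obtain ⟨c, -, hc0, hc⟩ := exists_ne_lt_card_pairedElements h2 hG (by omega) hA b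
  by_cases hb : b = 0
  · obtain ⟨j, rfl⟩ : ∃ j, k = 4 + 2 * j := ⟨(k - 4) / 2, by omega⟩
    exact IsSubsetSum.add_pairs h2 hc0 (key _ le_rfl (by omega) (by norm_num)) (by omega)
  · obtain ⟨j, rfl⟩ : ∃ j, k = 2 + 2 * j := ⟨(k - 2) / 2, by omega⟩
    refine IsSubsetSum.add_pairs h2 hc0 (isSubsetSum_two h2 (by omega) ?_) (by omega)
    rwa [even_nsmul_of_two h2 (Nat.even_iff.2 (by omega)), add_zero]

/-- At most one element is not a sum of three distinct elements of `A`. -/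
theorem eq_of_not_isSubsetSum_three (h2 : ∀ x : G, x + x = 0)
    (hG : Fintype.card G = 16 * M) (hM : 0 < M) (hA : A.card = 8 * M + 1) {b b' : G}
    (hb : ¬ IsSubsetSum A 3 b) (hb' : ¬ IsSubsetSum A 3 b') : b = b' := by
  by_contra hne
  have hcard : ∀ x : G, (A.image (x + ·)).card = 8 * M + 1 := fun x => by
    rw [Finset.card_image_of_injective _ (add_right_injective x), hA]
  -- Equal translates would make `A` stable under `b + b'`, against its odd size.
  have himage : A.image (b + ·) ≠ A.image (b' + ·) := by
    intro h
    have hc : b + b' ≠ 0 := fun h => hne (eq_of_add_eq_zero_of_two h2 h)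
    have : Even A.card := by
      refine even_card_of_forall_add_mem h2 hc fun x hx => ?_
      have hx' : b + x ∈ A.image (b' + ·) := h ▸ Finset.mem_image_of_mem _ hx
      obtain ⟨y, hy, hyx⟩ := Finset.mem_image.1 hx'
      have : y = x + (b + b') := by
        rw [← zero_add y, ← h2 b', add_assoc, hyx]; abel
      exact this ▸ hy
    rw [hA, Nat.even_iff] at this
    omega
  set D := (A.image (b + ·) ∪ A.image (b' + ·)).erase 0 with hD
  have hDcard : 8 * M + 1 ≤ D.card := by
    have h1 : (A.image (b + ·)).card < (A.image (b + ·) ∪ A.image (b' + ·)).card := by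
      refine Finset.card_lt_card (Finset.ssubset_iff_subset_ne.2 ⟨Finset.subset_union_left, ?_⟩)
      intro h
      refine himage (Finset.eq_of_subset_of_card_le ?_ ?_).symm
      · exact Finset.union_eq_left.1 h.symm
      · rw [hcard, hcard]
    have h3 := Finset.pred_card_le_card_erase (s := A.image (b + ·) ∪ A.image (b' + ·)) (a := 0)
    rw [← hD] at h3
    rw [hcard] at h1
    omega
  -- So many poorly paired differences force some `c` above the maximum `8 * M`.
  obtain ⟨c, -, hc0, hc⟩ := exists_le_card_pairedElements (A := A) (D := D) (u := 2) (v := 8 * M)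
    (Finset.notMem_erase _ _) (by
      intro d hd
      rw [hD, Finset.erase_union_distrib, Finset.mem_union] at hd
      rcases hd with hd | hd
      · exact card_pairedElements_le_two_of_not_isSubsetSum_three h2 hb hd
      · exact card_pairedElements_le_two_of_not_isSubsetSum_three h2 hb' hd) (by
      have h0 : D.card ≤ 16 * M - 1 := by
        have := Finset.card_le_card (Finset.erase_subset_erase 0
          (Finset.subset_univ (A.image (b + ·) ∪ A.image (b' + ·))))
        rwa [Finset.card_erase_of_mem (Finset.mem_univ _), Finset.card_univ, hG] at this
      rw [hA, hG]
      obtain ⟨m, rfl⟩ : ∃ m, M = m + 1 := ⟨M - 1, by omega⟩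
      obtain ⟨e, he⟩ := Nat.exists_eq_add_of_le hDcard
      have h3 : 16 * (m + 1) - 1 - D.card + e = 8 * m + 6 := by omega
      rw [← hD] at *
      generalize 16 * (m + 1) - 1 - D.card = f at *
      rw [he]
      nlinarith [Nat.zero_le (m * e), Nat.zero_le e])
  have := card_pairedElements_le h2 hA hc0
  omega

/-- A failing `b` leaves about half of all differences with at most two paired elements, so another
one pairs all but one element of `A`. This makes room for a start of five. -/
theorem exists_le_card_pairedElements_of_not_isSubsetSum_three (h2 : ∀ x : G, x + x = 0)
    (hG : Fintype.card G = 16 * M) (hM : 0 < M) (hA : A.card = 8 * M + 1) {b : G}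
    (hb : ¬ IsSubsetSum A 3 b) : ∃ c ≠ 0, 8 * M ≤ (pairedElements A c).card := by
  set D := (A.image (b + ·)).erase 0 with hD
  have hcard : (A.image (b + ·)).card = 8 * M + 1 := by
    rw [Finset.card_image_of_injective _ (add_right_injective b), hA]
  have hDcard : 8 * M ≤ D.card := by
    have h3 := Finset.pred_card_le_card_erase (s := A.image (b + ·)) (a := 0)
    rw [← hD] at h3
    omega
  have hDcard' : D.card ≤ 8 * M + 1 := hcard ▸ Finset.card_erase_le
  obtain ⟨c, -, hc0, hc⟩ := exists_le_card_pairedElements (A := A) (D := D) (u := 2)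
    (v := 8 * M - 1) (Finset.notMem_erase _ _)
    (fun d hd => card_pairedElements_le_two_of_not_isSubsetSum_three h2 hb hd) (by
      rw [hA, hG]
      obtain ⟨m, rfl⟩ : ∃ m, M = m + 1 := ⟨M - 1, by omega⟩
      have h4 : 8 * (m + 1) - 1 = 8 * m + 7 := by omega
      rw [h4]
      obtain h | h : D.card = 8 * (m + 1) ∨ D.card = 8 * (m + 1) + 1 := by omega
      · have h5 : 16 * (m + 1) - 1 - D.card = 8 * m + 7 := by omega
        rw [h5, h]; nlinarith
      · have h5 : 16 * (m + 1) - 1 - D.card = 8 * m + 6 := by omega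
        rw [h5, h]; nlinarith)
  exact ⟨c, hc0, by omega⟩

/-- Start from three elements. If `k % 4 = 1`, choose `c` so that `b + c` is not the exceptional
three-sum. If `k % 4 = 3`, the target is `b`; should it be exceptional, start from five. -/
theorem isSubsetSum_of_odd (h2 : ∀ x : G, x + x = 0)
    (hG : Fintype.card G = 16 * M) (hA : A.card = 8 * M + 1) {k : ℕ}
    (hk : 4 ≤ k) (hkM : k ≤ 4 * M) (hko : Odd k) (b : G) : IsSubsetSum A k b := by
  have key : ∀ {k : ℕ} (b : G), 4 ≤ k → k ≤ 4 * M → k % 4 = 1 → IsSubsetSum A k b := by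
    intro k b hk hkM hk4
    have hM : 0 < M := by omega
    obtain ⟨e, he⟩ : ∃ e, ∀ c ≠ e, IsSubsetSum A 3 (b + c) := by
      by_cases h : ∃ b', ¬ IsSubsetSum A 3 b'
      · obtain ⟨b', hb'⟩ := h
        refine ⟨b' - b, fun c hc => ?_⟩
        by_contra h
        refine hc ?_
        rw [← eq_of_not_isSubsetSum_three h2 hG hM hA h hb']; abel
      · push Not at h
        exact ⟨0, fun c _ => h _⟩
    obtain ⟨c, hce, hc0, hc⟩ := exists_ne_lt_card_pairedElements h2 hG hM hA e
    obtain ⟨j, rfl⟩ : ∃ j, k = 3 + 2 * j := ⟨(k - 3) / 2, by omega⟩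
    refine IsSubsetSum.add_pairs h2 hc0 ?_ (by omega)
    rw [odd_nsmul_of_two h2 (Nat.odd_iff.2 (by omega))]
    exact he c hce
  rw [Nat.odd_iff] at hko
  by_cases hk4 : k % 4 = 1
  · exact key b hk hkM hk4
  by_cases hb : IsSubsetSum A 3 b
  · obtain ⟨c, -, hc0, hc⟩ := exists_ne_lt_card_pairedElements h2 hG (by omega) hA b
    obtain ⟨j, rfl⟩ : ∃ j, k = 3 + 2 * j := ⟨(k - 3) / 2, by omega⟩
    refine IsSubsetSum.add_pairs h2 hc0 ?_ (by omega)
    rwa [even_nsmul_of_two h2 (Nat.even_iff.2 (by omega)), add_zero]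
  · obtain ⟨c, hc0, hc⟩ :=
      exists_le_card_pairedElements_of_not_isSubsetSum_three h2 hG (by omega) hA hb
    obtain ⟨j, rfl⟩ : ∃ j, k = 5 + 2 * j := ⟨(k - 5) / 2, by omega⟩
    exact IsSubsetSum.add_pairs h2 hc0 (key _ (by norm_num) (by omega) (by norm_num)) (by omega)

theorem isSubsetSum_of_card_eq (h2 : ∀ x : G, x + x = 0)
    (hG : Fintype.card G = 16 * M) (hA : A.card = 8 * M + 1) {k : ℕ}
    (hk : 4 ≤ k) (hkM : k + 3 ≤ 8 * M) (b : G) : IsSubsetSum A k b := by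
  have key : ∀ {k : ℕ} (b : G), 4 ≤ k → k ≤ 4 * M → IsSubsetSum A k b := by
    intro k b hk hkM
    rcases Nat.even_or_odd k with h | h
    · exact isSubsetSum_of_even h2 hG hA hk hkM h b
    · exact isSubsetSum_of_odd h2 hG hA hk hkM h b
  by_cases h : k ≤ 4 * M
  · exact key b hk h
  · exact IsSubsetSum.compl (k := 8 * M + 1 - k) (by omega) (key _ (by omega) (by omega))

end HalfPlusOne

/-- In an elementary abelian `2`-group, every element is a sum of `k` distinct elements of a
subset with more than half (or, for extreme `k`, one element more) of all elements. -/
theorem isSubsetSum_of_half_lt_card (h2 : ∀ x : G, x + x = 0) {M : ℕ}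
    (hG : Fintype.card G = 16 * M) {A : Finset G} {k : ℕ} (hk : 3 ≤ k) (hkM : k + 2 ≤ 8 * M)
    (hA : if k = 3 ∨ k + 2 = 8 * M then 8 * M + 1 < A.card else 8 * M < A.card) (b : G) :
    IsSubsetSum A k b := by
  split_ifs at hA with h
  · rcases h with rfl | h
    · exact isSubsetSum_three h2 (by omega) b
    -- Here `k = 8 * M - 2`: within `8 * M + 2` elements the complement has size 4, avoiding the
    -- possible exception for three-sums.
    · obtain ⟨B, hBA, hB⟩ := Finset.exists_subset_card_eq (show 8 * M + 2 ≤ A.card by omega)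
      obtain ⟨B', hBB', hB'⟩ := Finset.exists_subset_card_eq (show 8 * M + 1 ≤ B.card by omega)
      refine IsSubsetSum.mono (IsSubsetSum.compl (k := 4) (by omega) ?_) hBA
      exact (isSubsetSum_of_card_eq h2 hG hB' le_rfl (by omega) _).mono hBB'
  · obtain ⟨B, hBA, hB⟩ := Finset.exists_subset_card_eq (show 8 * M + 1 ≤ A.card by omega)
    exact (isSubsetSum_of_card_eq h2 hG hB (by omega) (by omega) b).mono hBA

end SubsetSums

/-! ### From subset sums to low-weight codewords -/

section TwistedCode

variable {F : Type*} [Field F] {n k : ℕ}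

theorem finrank_twistedRSCode_le {ℓ : ℕ} (α : Fin n → F) (t : Fin ℓ → ℕ) (h : Fin ℓ → Fin k)
    (η : Fin ℓ → F) : Module.finrank F (twistedRSCode k α t h η) ≤ k := by
  let φ : (Fin k → F) →ₗ[F] F[X] :=
    { toFun := fun f => ∑ i : Fin k, C (f i) * X ^ (i : ℕ) +
        ∑ j : Fin ℓ, C (η j * f (h j)) * X ^ (k - 1 + t j)
      map_add' := fun f g => by
        simp only [Pi.add_apply, mul_add, C_add, add_mul, Finset.sum_add_distrib]
        ring
      map_smul' := fun c f => by
        simp only [Pi.smul_apply, smul_eq_mul, smul_add, Finset.smul_sum, smul_eq_C_mul, C_mul,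
          RingHom.id_apply]
        congr 1 <;> exact Finset.sum_congr rfl fun _ _ => by ring }
  have hφ : twistedPolynomials k t h η = LinearMap.range φ := by
    ext p
    exact ⟨fun ⟨f, hf⟩ => ⟨f, hf.symm⟩, fun ⟨f, hf⟩ => ⟨f, hf.symm⟩⟩
  rw [twistedRSCode, hφ, ← LinearMap.range_comp]
  simpa using LinearMap.finrank_range_le ((evaluationMap α).comp φ)

/-- The monic polynomial with `k` given roots of sum `-η⁻¹` is a twisted polynomial. -/
theorem prod_X_sub_C_mem_twistedPolynomials (hk : 0 < k) {η : F} (hη : η ≠ 0) {S : Finset F}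
    (hS : S.card = k) (hsum : ∑ x ∈ S, x = -η⁻¹) :
    ∏ x ∈ S, (X - C x) ∈
      twistedPolynomials k ![1] ![⟨k - 1, Nat.sub_one_lt_of_lt hk⟩] ![η] := by
  set p : F[X] := ∏ x ∈ S, (X - C x) with hp
  have hmonic : p.Monic := monic_prod_of_monic _ _ fun x _ => monic_X_sub_C x
  have hdeg : p.natDegree = k := by rw [hp, natDegree_finsetProd_X_sub_C_eq_card, hS]
  -- This makes the twist coefficient `η * η⁻¹` equal to the leading coefficient 1.
  have hcoeff : p.coeff (k - 1) = η⁻¹ := by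
    have := prod_X_sub_C_coeff_card_pred S (fun x : F => x) (by omega)
    rwa [hS, hsum, neg_neg, ← hp] at this
  refine ⟨fun i => p.coeff i, ?_⟩
  conv_lhs => rw [hmonic.as_sum, hdeg]
  rw [Finset.sum_range, add_comm]
  simp [hcoeff, hη, Nat.sub_add_cancel hk]

theorem not_isMDS_of_isSubsetSum [DecidableEq F] (hk : 0 < k) (hkn : k < n) {α : Fin n → F}
    (hα : Function.Injective α) {η : F} (hη : η ≠ 0)
    (h : IsSubsetSum (Finset.univ.image α) k (-η⁻¹)) :
    ¬ IsMDS (twistedRSCode k α ![1] ![⟨k - 1, Nat.sub_one_lt_of_lt hk⟩] ![η]) := by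
  obtain ⟨S, hSα, hS, hsum⟩ := h
  have hp := prod_X_sub_C_mem_twistedPolynomials hk hη hS hsum
  set w : Fin n → F := evaluationMap α (∏ x ∈ S, (X - C x)) with hw
  have hwi : ∀ i, w i = 0 ↔ α i ∈ S := by
    intro i
    simp [hw, evaluationMap, Polynomial.leval, eval_prod, Finset.prod_eq_zero_iff, sub_eq_zero]
  have hzeros : (Finset.univ.filter fun i => w i = 0).card = k := by
    rw [← hS, ← Finset.card_image_of_injective _ hα]
    congr 1
    ext x
    simp only [hwi, Finset.mem_image, Finset.mem_filter, Finset.mem_univ, true_and]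
    refine ⟨fun ⟨i, hi, hx⟩ => hx ▸ hi, fun hx => ?_⟩
    obtain ⟨i, -, rfl⟩ := Finset.mem_image.1 (hSα hx)
    exact ⟨i, hx, rfl⟩
  have hsplit := Finset.card_filter_add_card_filter_not (s := Finset.univ) fun i => w i = 0
  rw [hzeros, Finset.card_univ, Fintype.card_fin] at hsplit
  have hne : w ≠ 0 := by
    rintro h0
    rw [h0] at hzeros
    simp at hzeros
    omega
  have hdist : hammingDist w 0 = n - k := by
    rw [hammingDist_zero_right]
    change k + hammingNorm w = n at hsplit
    omega
  have hmin : minimumDistance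
      (twistedRSCode k α ![1] ![⟨k - 1, Nat.sub_one_lt_of_lt hk⟩] ![η]) ≤ n - k :=
    Nat.sInf_le ⟨w, Submodule.mem_map_of_mem hp, 0, zero_mem _, hne, hdist⟩
  have hrank := finrank_twistedRSCode_le α ![1] ![⟨k - 1, Nat.sub_one_lt_of_lt hk⟩] ![η]
  rw [IsMDS]
  omega

end TwistedCode

/-- An even prime power above 8 is a power of two with exponent at least 4. -/
theorem two_eq_zero_and_sixteen_dvd_card {F : Type*} [Field F] [Fintype F]
    (hq : Even (Fintype.card F)) (hq' : 8 < Fintype.card F) :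
    (2 : F) = 0 ∧ 16 ∣ Fintype.card F := by
  obtain ⟨m, hp, hm⟩ := FiniteField.card F (ringChar F)
  have hchar : ringChar F = 2 := by
    rw [hm, Nat.even_pow' m.ne_zero] at hq
    exact (Nat.Prime.even_iff hp).1 hq
  refine ⟨by simpa [hchar] using ringChar.Nat.cast_ringChar (R := F), ?_⟩
  rw [hchar] at hm
  rw [hm] at hq' ⊢
  have h4 : 3 < (m : ℕ) := (Nat.pow_lt_pow_iff_right (a := 2) (by norm_num)).1 (by simpa using hq')
  exact pow_dvd_pow 2 (show 4 ≤ (m : ℕ) from h4)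

theorem mainTheorem10 {F : Type*} [Field F] [Fintype F] [DecidableEq F]
    (hq : Even (Fintype.card F)) (n k : ℕ) (hk : 3 ≤ k) (hkq : k + 2 ≤ Fintype.card F / 2)
    (hn : if k = 3 ∨ k + 2 = Fintype.card F / 2
      then Fintype.card F / 2 + 1 < n else Fintype.card F / 2 < n)
    (α : Fin n → F) (hα : Function.Injective α) (η : F) (hη : η ≠ 0) :
    ¬ IsMDS (twistedRSCode k α ![1] ![⟨k - 1, Nat.sub_one_lt_of_lt hk⟩] ![η]) := by
  obtain ⟨h2, M, hM⟩ := two_eq_zero_and_sixteen_dvd_card hq (by omega)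
  have hhalf : Fintype.card F / 2 = 8 * M := by omega
  rw [hhalf] at hn hkq
  have hcard : (Finset.univ.image α).card = n := by
    rw [Finset.card_image_of_injective _ hα, Finset.card_univ, Fintype.card_fin]
  refine not_isMDS_of_isSubsetSum (by omega) (by split_ifs at hn <;> omega) hα hη ?_
  refine isSubsetSum_of_half_lt_card (fun x => ?_) hM hk hkq (by rwa [hcard]) _
  rw [← two_mul, h2, zero_mul]
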